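/- Let $\alpha>0$ and, for $t>0$, let $w(x,t)=(1-x^2)^\alpha e^{-t/x^2}$ on $[-1,1]$. For an integer $n\ge 0$ let $$D_n(t)=\det\left(\int_{-1}^1 x^{j+k}w(x,t)\,dx\right)_{j,k=0}^{n-1}\qquad(D_0=1),$$ let $P_j(x,t)$ be the monic polynomials of degree $j$ ($j=0,1,2,\dots$) orthogonal with respect to $w(\cdot,t)$ on $[-1,1]$ (obtained from the monomials by Gram–Schmidt), and put $$h_j(t)=\int_{-1}^1P_j(x,t)^2w(x,t)\,dx,\qquad R_j(t)=\frac{2t}{h_j(t)}\int_{-1}^1\frac{P_j(y,t)^2w(y,t)}{y^2}\,dy .$$ Then the $P_j$ are well defined with $h_j(t)>0$, $D_n$ is positive and differentiable on $(0,\infty)$, and the function $$\sigma_n(t):=2t\,\frac{d}{dt}\ln D_n(t),\qquad t>0,$$ satisfies $\sigma_n(t)=-\sum_{j=0}^{n-1}R_j(t)$, is twice differentiable on $(0,\infty)$, and satisfies, for every $t>0$, the second-order nonlinear ordinary differential equation (with $\sigma_n,\sigma_n',\sigma_n''$ evaluated at $t$) $$\begin{aligned} &\Big\{4t^3(\sigma_n'')^2-4t^2\left[2t+2\alpha-2(-1)^n(n+\alpha)-\sigma_n'\right]\sigma_n''+8t^2(\sigma_n')^3\\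 &\quad-t\left[4t^2+40\alpha t-1+4\sigma_n+24(-1)^nt(n+\alpha)\right](\sigma_n')^2\\ &\quad+4t\left[12\alpha t^2-(20n^2+40n\alpha+3)t-\alpha+(-1)^n(n+\alpha)(12t^2+1)+4\left(\alpha-t+3(-1)^n(n+\alpha)\right)\sigma_n\right]\sigma_n'\\ &\quad+8\left[t-2(-1)^n(n+\alpha)\right]\sigma_n^2+4t\left[2t^2+1+14n^2+28n\alpha+8\alpha^2-4(-1)^n(n+\alpha)(3t+2\alpha)\right]\sigma_n\\ &\quad-4t\big[4\alpha t^3-2t^2(7n^2+14n\alpha+1)-4\alpha t(3n^2+6n\alpha+1)-n^2-2n\alpha-2\alpha^2\\ &\qquad+2(-1)^n\left(2t^3(n+\alpha)+2\left(3n^3+9n^2\alpha+n(6\alpha^2+1)+\alpha\right)t+n\alpha+\alpha^2\right)\big]\Big\}^2\\ &=16\Big\{t\left[t+2\alpha-2\sigma_n'-2(-1)^n(n+\alpha)\right]+\sigma_n\Big\}\\ &\quad\times\Big\{2(-1)^nt^2\sigma_n''+t\left[(-1)^n(4n^2+8n\alpha-8\alpha t+1+4\sigma_n)-8t(n+\alpha)\right]\sigma_n'-2(-1)^n\sigma_n^2\\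 &\qquad+2\left[4t(n+\alpha)-(-1)^n(n^2+2n\alpha+t^2)\right]\sigma_n\\ &\qquad+2t\left[(n+\alpha)(2n^2+4n\alpha+2t^2+1)+(-1)^n\left(2\alpha t^2-(5n^2+10n\alpha+1)t-\alpha(2n^2+4n\alpha+1)\right)\right]\Big\}^2. \end{aligned}$$ -/

import Mathlib

/-- The singularly perturbed Jacobi weight `w(x,t) = (1 - x²)^α exp(-t/x²)` on `[-1,1]`. -/
noncomputable def jacobiWeight (α t x : ℝ) : ℝ :=
  (1 - x ^ 2) ^ α * Real.exp (-(t / x ^ 2))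

/-- The moments `μ_k(t) = ∫_{-1}^{1} x^k w(x,t) dx`. -/
noncomputable def jacobiMoment (α t : ℝ) (k : ℕ) : ℝ :=
  ∫ x in (-1 : ℝ)..1, x ^ k * jacobiWeight α t x

/-- The Hankel determinant `D_n(t) = det (μ_{j+k}(t))`, `0 ≤ j, k ≤ n - 1`. -/
noncomputable def hankelD (α : ℝ) (n : ℕ) (t : ℝ) : ℝ :=
  Matrix.det (Matrix.of fun j k : Fin n => jacobiMoment α t ((j : ℕ) + (k : ℕ)))

/-- The pairing `∫_{-1}^{1} p(x) q(x) w(x,t) dx` of two real polynomials. -/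
noncomputable def jacobiPairing (α t : ℝ) (p q : Polynomial ℝ) : ℝ :=
  ∫ x in (-1 : ℝ)..1, p.eval x * q.eval x * jacobiWeight α t x

/-- The monic orthogonal polynomials `P_n(·,t)` of the weight `w(·,t)`, obtained from the monomials
by Gram–Schmidt orthogonalization without normalization. -/
noncomputable def jacobiP (α t : ℝ) (n : ℕ) : Polynomial ℝ :=
  Polynomial.X ^ n - ∑ j : Fin n,
    Polynomial.C (jacobiPairing α t (Polynomial.X ^ n) (jacobiP α t j) /
      jacobiPairing α t (jacobiP α t j) (jacobiP α t j)) * jacobiP α t j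
termination_by n
decreasing_by all_goals exact j.isLt

/-- The squared norm `h_n(t) = ∫_{-1}^{1} P_n(x,t)² w(x,t) dx`. -/
noncomputable def jacobiH (α t : ℝ) (n : ℕ) : ℝ :=
  jacobiPairing α t (jacobiP α t n) (jacobiP α t n)

/-- `R_n(t) = (2t / h_n(t)) ∫_{-1}^{1} P_n(y,t)² w(y,t) / y² dy`. -/
noncomputable def auxR (α : ℝ) (n : ℕ) (t : ℝ) : ℝ :=
  2 * t / jacobiH α t n *
    ∫ y in (-1 : ℝ)..1, (jacobiP α t n).eval y ^ 2 * jacobiWeight α t y / y ^ 2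

/-- `σ_n(t) = 2t (d/dt) ln D_n(t)`. -/
noncomputable def sigmaN (α : ℝ) (n : ℕ) (t : ℝ) : ℝ :=
  2 * t * deriv (fun s => Real.log (hankelD α n s)) t

/-- `P` is the sequence of monic orthogonal polynomials of the weight `w(·,t)`: `P_j` is monic of
degree `j`, and `∫_{-1}^{1} P_j P_k w dx` is zero for `j ≠ k` and positive for `j = k`. -/
structure IsMonicOrthogonal (α t : ℝ) (P : ℕ → Polynomial ℝ) : Prop where
  monic : ∀ j, (P j).Monic
  natDegree_eq : ∀ j, (P j).natDegree = j
  orthogonal : ∀ j k, j ≠ k → jacobiPairing α t (P j) (P k) = 0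
  norm_pos : ∀ j, 0 < jacobiPairing α t (P j) (P j)

/-- The second-order equation at a point: `s, s1, s2` stand for the values of the function, of its
first and of its second derivative at `t`, and `e` stands for the sign `(-1)^n`. -/
def SigmaODE (α : ℝ) (n : ℕ) (t s s1 s2 : ℝ) : Prop :=
  let e : ℝ := (-1) ^ n
  (4 * t ^ 3 * s2 ^ 2
    - 4 * t ^ 2 * (2 * t + 2 * α - 2 * e * (n + α) - s1) * s2
    + 8 * t ^ 2 * s1 ^ 3
    - t * (4 * t ^ 2 + 40 * α * t - 1 + 4 * s + 24 * e * t * (n + α)) * s1 ^ 2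
    + 4 * t * (12 * α * t ^ 2 - (20 * n ^ 2 + 40 * n * α + 3) * t - α
        + e * (n + α) * (12 * t ^ 2 + 1)
        + 4 * (α - t + 3 * e * (n + α)) * s) * s1
    + 8 * (t - 2 * e * (n + α)) * s ^ 2
    + 4 * t * (2 * t ^ 2 + 1 + 14 * n ^ 2 + 28 * n * α + 8 * α ^ 2
        - 4 * e * (n + α) * (3 * t + 2 * α)) * s
    - 4 * t * (4 * α * t ^ 3 - 2 * t ^ 2 * (7 * n ^ 2 + 14 * n * α + 1)
        - 4 * α * t * (3 * n ^ 2 + 6 * n * α + 1) - n ^ 2 - 2 * n * α - 2 * α ^ 2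
        + 2 * e * (2 * t ^ 3 * (n + α)
            + 2 * (3 * n ^ 3 + 9 * n ^ 2 * α + n * (6 * α ^ 2 + 1) + α) * t
            + n * α + α ^ 2))) ^ 2
  = 16 * (t * (t + 2 * α - 2 * s1 - 2 * e * (n + α)) + s)
    * (2 * e * t ^ 2 * s2
      + t * (e * (4 * n ^ 2 + 8 * n * α - 8 * α * t + 1 + 4 * s) - 8 * t * (n + α)) * s1
      - 2 * e * s ^ 2
      + 2 * (4 * t * (n + α) - e * (n ^ 2 + 2 * n * α + t ^ 2)) * s
      + 2 * t * ((n + α) * (2 * n ^ 2 + 4 * n * α + 2 * t ^ 2 + 1)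
          + e * (2 * α * t ^ 2 - (5 * n ^ 2 + 10 * n * α + 1) * t
              - α * (2 * n ^ 2 + 4 * n * α + 1)))) ^ 2

/-! Write β_n for `recCoeff`, r_n for `ladderCoeff`, R_n for `auxR`, and e = (-1)^n. The factor
exp(-t/x²) kills every pole at 0, so the integrals of p w x^(-m) converge and differentiating in t
merely raises m by two.

Evenness of w gives x P_n = P_{n+1} + β_n P_{n-1}. This recurrence and one integration by parts
(`weightIntegral_pearson`) yield difference equations in n. They telescope to `compatibility_one`,
`compatibility_two` and `compatibility_three`, algebraic relations between β_n, r_n, R_n, R_{n-1}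
and the sum of R_j over j < n, and these make β_n linear in r_n and that sum (`recCoeff_mul_eq`).

In t, h_n' = -h_n R_n/(2t), which with D_n = ∏ h_j identifies the sum as -σ_n. Put a = β_n
(2(n+α)+1) R_{n-1} and b = β_n (2(n+α)-1) R_n. Then 2t r_n' = a - b, while a + b is affine in t σ_n'
and t. Hence a quadratic equation for r_n (`ladderCoeff_quadratic`) and, from (a-b)² = (a+b)² - 4ab,
a formula for (r_n')² (`ladderCoeff_deriv_sq`).

With y = r_n + e t, the quadratic gives y² and its derivative gives y r_n'. Eliminating r_n' leaves
E + 4yG = 0 with E, G free of r_n, and E² = 16 y² G² is the equation (`sigmaODE_of_quadratic`). -/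

open Polynomial MeasureTheory

/-! ### Bounds for the weight near its essential singularity. -/

section Weight

variable {α t x : ℝ}

theorem jacobiWeight_nonneg (hx : x ^ 2 ≤ 1) : 0 ≤ jacobiWeight α t x :=
  mul_nonneg (Real.rpow_nonneg (by linarith) _) (Real.exp_pos _).le

theorem jacobiWeight_pos (hx : x ^ 2 < 1) : 0 < jacobiWeight α t x :=
  mul_pos (Real.rpow_pos_of_pos (by linarith) _) (Real.exp_pos _)

theorem jacobiWeight_neg : jacobiWeight α t (-x) = jacobiWeight α t x := by
  simp [jacobiWeight]

theorem measurable_jacobiWeight : Measurable (jacobiWeight α t) := by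
  unfold jacobiWeight
  fun_prop

/-- One term of the exponential series, (t/x²)^m / m! ≤ exp(t/x²), outweighs the pole with a factor
|x|^m to spare. -/
theorem exp_neg_div_sq_div_pow_le (ht : 0 < t) (hx : x ^ 2 ≤ 1) (m : ℕ) :
    |Real.exp (-(t / x ^ 2)) / x ^ m| ≤ m.factorial / t ^ m := by
  rcases eq_or_ne x 0 with rfl | hx0
  -- Division by zero returns 0, so at x = 0 the exponential is 1 and the quotient is 1 for m = 0
  -- and 0 otherwise.
  · rcases m with _ | m
    · simp
    · simp; positivity
  have hx' : 0 < |x| := abs_pos.2 hx0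
  have hx1 : |x| ≤ 1 := (sq_le_one_iff_abs_le_one x).1 hx
  have hexp := Real.pow_div_factorial_le_exp (t / x ^ 2) (by positivity) m
  rw [abs_div, abs_pow, abs_of_pos (Real.exp_pos _), Real.exp_neg, div_le_div_iff₀ (by positivity)
    (by positivity)]
  have hfac : (0 : ℝ) < m.factorial := by positivity
  rw [div_pow, ← pow_mul, mul_comm 2 m, pow_mul, ← sq_abs (x ^ m), abs_pow, div_div,
    div_le_iff₀ (by positivity)] at hexp
  rw [inv_mul_le_iff₀ (Real.exp_pos _)]
  have hxm : |x| ^ m ≤ 1 := pow_le_one₀ hx'.le hx1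
  calc t ^ m ≤ Real.exp (t / x ^ 2) * ((|x| ^ m) ^ 2 * m.factorial) := hexp
    _ = Real.exp (t / x ^ 2) * (m.factorial * |x| ^ m) * |x| ^ m := by ring
    _ ≤ Real.exp (t / x ^ 2) * (m.factorial * |x| ^ m) * 1 := by gcongr
    _ = _ := by ring

theorem jacobiWeight_div_pow_le (hα : 0 < α) (ht : 0 < t) (hx : x ^ 2 ≤ 1) (m : ℕ) :
    |jacobiWeight α t x / x ^ m| ≤ m.factorial / t ^ m := by
  have h := exp_neg_div_sq_div_pow_le ht hx m
  have h1 : (1 - x ^ 2) ^ α ≤ 1 :=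
    Real.rpow_le_one (by linarith) (by nlinarith [sq_nonneg x]) hα.le
  have h0 : 0 ≤ (1 - x ^ 2) ^ α := Real.rpow_nonneg (by linarith) _
  rw [jacobiWeight, mul_div_assoc, abs_mul, abs_of_nonneg h0]
  calc _ ≤ 1 * (m.factorial / t ^ m : ℝ) := by gcongr
    _ = _ := one_mul _

theorem sq_le_one_of_mem_uIoc (hx : x ∈ Set.uIoc (-1 : ℝ) 1) : x ^ 2 ≤ 1 := by
  rw [Set.uIoc_of_le (by norm_num)] at hx
  nlinarith [hx.1, hx.2]

end Weight

/-! ### Integrals against w x^(-m): parity, positivity, t-derivative, integration by parts. -/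

/-- The functional `p ↦ ∫_{-1}^{1} p(x) w(x,t) x^{-m} dx`. -/
noncomputable def weightIntegral (α t : ℝ) (m : ℕ) (p : ℝ[X]) : ℝ :=
  ∫ x in (-1 : ℝ)..1, p.eval x * (jacobiWeight α t x / x ^ m)

section WeightIntegral

variable {α t : ℝ} (hα : 0 < α) (ht : 0 < t)
include hα ht

theorem intervalIntegrable_weight (m : ℕ) (p : ℝ[X]) :
    IntervalIntegrable (fun x => p.eval x * (jacobiWeight α t x / x ^ m)) volume (-1) 1 := by
  have hw : IntervalIntegrable (fun x => jacobiWeight α t x / x ^ m) volume (-1) 1 := by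
    rw [intervalIntegrable_iff]
    refine Measure.integrableOn_of_bounded (M := m.factorial / t ^ m) ?_ ?_ ?_
    · simp
    · exact (measurable_jacobiWeight.div (by fun_prop)).aestronglyMeasurable
    · refine (ae_restrict_iff' measurableSet_uIoc).2 (Filter.Eventually.of_forall fun x hx => ?_)
      exact jacobiWeight_div_pow_le hα ht (sq_le_one_of_mem_uIoc hx) m
  exact hw.continuousOn_mul p.continuous.continuousOn

theorem weightIntegral_add (m : ℕ) (p q : ℝ[X]) :
    weightIntegral α t m (p + q) = weightIntegral α t m p + weightIntegral α t m q := by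
  unfold weightIntegral
  rw [← intervalIntegral.integral_add (intervalIntegrable_weight hα ht m p)
    (intervalIntegrable_weight hα ht m q)]
  simp only [eval_add, add_mul]

omit hα ht in
theorem weightIntegral_C_mul (m : ℕ) (c : ℝ) (p : ℝ[X]) :
    weightIntegral α t m (C c * p) = c * weightIntegral α t m p := by
  unfold weightIntegral
  rw [← intervalIntegral.integral_const_mul]
  simp only [eval_mul, eval_C, mul_assoc]

theorem weightIntegral_sub (m : ℕ) (p q : ℝ[X]) :
    weightIntegral α t m (p - q) = weightIntegral α t m p - weightIntegral α t m q := by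
  have h := weightIntegral_C_mul (α := α) (t := t) m (-1) q
  rw [sub_eq_add_neg, weightIntegral_add hα ht]
  simp at h
  rw [h]; ring

theorem weightIntegral_sum {ι : Type*} (s : Finset ι) (m : ℕ) (f : ι → ℝ[X]) :
    weightIntegral α t m (∑ i ∈ s, f i) = ∑ i ∈ s, weightIntegral α t m (f i) := by
  classical
  induction s using Finset.induction_on with
  | empty => simp [weightIntegral]
  | insert a s ha ih => rw [Finset.sum_insert ha, Finset.sum_insert ha, weightIntegral_add hα ht, ih]

omit hα ht in
theorem weightIntegral_X_mul (m : ℕ) (p : ℝ[X]) :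
    weightIntegral α t (m + 1) (X * p) = weightIntegral α t m p := by
  unfold weightIntegral
  refine intervalIntegral.integral_congr_ae ?_
  filter_upwards [compl_mem_ae_iff.2 (measure_singleton (0 : ℝ))] with x hx _
  have : x ≠ 0 := hx
  simp only [eval_mul, eval_X, pow_succ]
  field_simp

omit hα ht in
-- Since w is even, the integrand p w x^(-m) is odd.
theorem weightIntegral_eq_zero_of_comp_neg (m : ℕ) (p : ℝ[X])
    (hp : p.comp (-X) = C ((-1) ^ (m + 1)) * p) : weightIntegral α t m p = 0 := by
  have h : weightIntegral α t m p = -weightIntegral α t m p := by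
    conv_lhs => rw [weightIntegral, ← neg_neg (1 : ℝ),
      ← intervalIntegral.integral_comp_neg (a := -1) (b := - -1)]
    rw [weightIntegral, ← intervalIntegral.integral_neg, neg_neg]
    congr 1
    ext x
    have hx : p.eval (-x) = (-1) ^ (m + 1) * p.eval x := by
      simpa using congrArg (eval x) hp
    rw [hx, jacobiWeight_neg, neg_pow x m]
    have h1 : ((-1 : ℝ) ^ m) * (-1) ^ m = 1 := by rw [← mul_pow]; simp
    have h2 : ((-1 : ℝ) ^ m)⁻¹ = (-1) ^ m := inv_eq_of_mul_eq_one_left h1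
    rw [div_eq_mul_inv, mul_inv, h2, pow_succ, div_eq_mul_inv]
    linear_combination (-(eval x p * jacobiWeight α t x * (x ^ m)⁻¹)) * h1
  linarith

theorem weightIntegral_mul_self_pos {p : ℝ[X]} (hp : p ≠ 0) :
    0 < weightIntegral α t 0 (p * p) := by
  have hint := intervalIntegrable_weight hα ht 0 (p * p)
  rw [weightIntegral, intervalIntegral.integral_of_le (by norm_num),
    setIntegral_pos_iff_support_of_nonneg_ae]
  · have hsub : Set.Ioo (-1 : ℝ) 1 \ (p.roots.toFinset : Set ℝ) ⊆
        Function.support (fun x => (p * p).eval x * (jacobiWeight α t x / x ^ 0)) ∩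
          Set.Ioc (-1) 1 := by
      rintro x ⟨hx, hr⟩
      refine ⟨?_, hx.1, hx.2.le⟩
      have h1 : p.eval x ≠ 0 := fun h => hr (by simp [hp, IsRoot, h])
      have h2 := (jacobiWeight_pos (α := α) (t := t) (show x ^ 2 < 1 by nlinarith [hx.1, hx.2])).ne'
      simp [h1, h2]
    refine lt_of_lt_of_le ?_ (measure_mono hsub)
    rw [measure_sdiff_null ((Finset.finite_toSet _).measure_zero _)]
    simp
  · refine (ae_restrict_iff' measurableSet_Ioc).2 (Filter.Eventually.of_forall fun x hx => ?_)
    have := jacobiWeight_nonneg (α := α) (t := t) (show x ^ 2 ≤ 1 by nlinarith [hx.1, hx.2])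
    simp only [eval_mul, pow_zero, div_one, Pi.zero_apply]
    exact mul_nonneg (mul_self_nonneg _) this
  · exact (intervalIntegrable_iff_integrableOn_Ioc_of_le (by norm_num)).1 hint

theorem hasDerivAt_weightIntegral (m : ℕ) (p : ℝ[X]) :
    HasDerivAt (fun s => weightIntegral α s m p) (-weightIntegral α t (m + 2) p) t := by
  have hmeas : ∀ (s : ℝ) (k : ℕ), Measurable fun x => p.eval x * (jacobiWeight α s x / x ^ k) :=
    fun s k => p.continuous.measurable.mul (measurable_jacobiWeight.div (by fun_prop))
  obtain ⟨M, hM⟩ := (isCompact_Icc (a := (-1 : ℝ)) (b := 1)).exists_bound_of_continuousOn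
    p.continuous.continuousOn
  have key := intervalIntegral.hasDerivAt_integral_of_dominated_loc_of_deriv_le (μ := volume)
    -- Staying in s > t/2 makes the bound (m+2)!/s^(m+2) uniform in s.
    (a := (-1 : ℝ)) (b := 1) (x₀ := t) (s := Set.Ioi (t / 2))
    (F := fun s x => p.eval x * (jacobiWeight α s x / x ^ m))
    (F' := fun s x => -(p.eval x * (jacobiWeight α s x / x ^ (m + 2))))
    (bound := fun _ => M * ((m + 2).factorial / (t / 2) ^ (m + 2)))
    (Ioi_mem_nhds (by linarith)) (Filter.Eventually.of_forall fun s => (hmeas s m).aestronglyMeasurable)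
    (intervalIntegrable_weight hα ht m p) (hmeas t (m + 2)).neg.aestronglyMeasurable
    (Filter.Eventually.of_forall fun x hx s hs => ?_) (by simp)
    (Filter.Eventually.of_forall fun x hx s hs => ?_)
  · have h := key.2
    rwa [intervalIntegral.integral_neg] at h
  · have hx1 := sq_le_one_of_mem_uIoc hx
    have hs' : t / 2 < s := hs
    have hs0 : 0 < s := by linarith
    rw [norm_neg, norm_mul]
    refine mul_le_mul (hM x ?_) ((jacobiWeight_div_pow_le hα hs0 hx1 (m + 2)).trans ?_)
      (norm_nonneg _) ((norm_nonneg _).trans (hM 0 (by simp)))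
    · rw [Set.uIoc_of_le (by norm_num)] at hx
      exact ⟨hx.1.le, hx.2⟩
    · have : 0 < t / 2 := by linarith
      gcongr
  · have h1 : HasDerivAt (fun s : ℝ => -(s / x ^ 2)) (-(1 / x ^ 2)) s :=
      ((hasDerivAt_id s).div_const _).neg
    have h2 := ((h1.exp.const_mul ((1 - x ^ 2) ^ α)).div_const (x ^ m)).const_mul (p.eval x)
    refine h2.congr_deriv ?_
    rcases eq_or_ne x 0 with rfl | hx0
    · simp
    · simp only [jacobiWeight, pow_add]; field_simp

/-- Integration by parts: `∫ ((1 - x²) p w)' dx = 0`. -/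
theorem weightIntegral_pearson (p : ℝ[X]) :
    weightIntegral α t 0 ((1 - X ^ 2) * derivative p) =
      2 * (1 + α) * weightIntegral α t 0 (X * p) - 2 * t * weightIntegral α t 3 ((1 - X ^ 2) * p) := by
  -- `expNegInvGlue (x ^ 2 / t)` is exp(-t/x²) extended by its limit 0 at x = 0. The literal
  -- expression takes the value 1 there, which would break continuity.
  set F : ℝ → ℝ := fun x => (1 - x ^ 2) ^ (α + 1) * (p.eval x * expNegInvGlue (x ^ 2 / t)) with hF
  set G : ℝ → ℝ := fun x => ((1 - X ^ 2) * derivative p).eval x * (jacobiWeight α t x / x ^ 0)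
    - 2 * (1 + α) * ((X * p).eval x * (jacobiWeight α t x / x ^ 0))
    + 2 * t * (((1 - X ^ 2) * p).eval x * (jacobiWeight α t x / x ^ 3)) with hG
  have i1 := intervalIntegrable_weight hα ht 0 ((1 - X ^ 2) * derivative p)
  have i2 := (intervalIntegrable_weight hα ht 0 (X * p)).const_mul (2 * (1 + α))
  have i3 := (intervalIntegrable_weight hα ht 3 ((1 - X ^ 2) * p)).const_mul (2 * t)
  have hint : ∫ x in (-1 : ℝ)..1, G x = F 1 - F (-1) := by
    refine integral_eq_of_hasDerivAt_off_countable F G (Set.countable_singleton (0 : ℝ)) ?_ ?_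
      ((i1.sub i2).add i3)
    · have h1 : Continuous fun x : ℝ => (1 - x ^ 2) ^ (α + 1) :=
        (continuous_const.sub (continuous_pow 2)).rpow_const fun x => Or.inr (by linarith)
      have h2 : Continuous expNegInvGlue := (expNegInvGlue.contDiff (n := 0)).continuous
      exact (h1.mul (p.continuous.mul (h2.comp (by fun_prop)))).continuousOn
    · rintro x ⟨hx, hx0⟩
      have hx0 : x ≠ 0 := hx0
      simp only [min_eq_left (show (-1 : ℝ) ≤ 1 by norm_num),
        max_eq_right (show (-1 : ℝ) ≤ 1 by norm_num)] at hx
      have hpos : 0 < 1 - x ^ 2 := by nlinarith [hx.1, hx.2]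
      have hEq : F =ᶠ[nhds x] fun y => (1 - y ^ 2) ^ (α + 1) *
          (p.eval y * Real.exp (-(t / y ^ 2))) := by
        filter_upwards [isOpen_ne.mem_nhds hx0] with y hy
        have hy : y ≠ 0 := hy
        have : ¬ y ^ 2 / t ≤ 0 := not_le.2 (by positivity)
        simp [hF, expNegInvGlue, this]
      refine HasDerivAt.congr_of_eventuallyEq ?_ hEq
      have d1 : HasDerivAt (fun y : ℝ => (1 - y ^ 2) ^ (α + 1))
          ((-(2 * x)) * (α + 1) * (1 - x ^ 2) ^ α) x := by
        have := ((hasDerivAt_pow 2 x).const_sub 1).rpow_const (p := α + 1) (Or.inr (by linarith))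
        simpa using this
      have d2 : HasDerivAt (fun y : ℝ => Real.exp (-(t / y ^ 2)))
          (Real.exp (-(t / x ^ 2)) * (2 * t / x ^ 3)) x := by
        have h := ((hasDerivAt_const x t).div (hasDerivAt_pow 2 x) (pow_ne_zero 2 hx0)).neg.exp
        refine h.congr_deriv ?_
        simp only [Pi.neg_apply, Pi.div_apply]
        field_simp
        push_cast
        ring
      refine (d1.mul ((p.hasDerivAt x).mul d2)).congr_deriv ?_
      have hpow : (1 - x ^ 2) ^ (α + 1) = (1 - x ^ 2) ^ α * (1 - x ^ 2) := by
        rw [Real.rpow_add hpos, Real.rpow_one]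
      simp only [hG, jacobiWeight, hpow, eval_mul, eval_sub, eval_one, eval_pow, eval_X, pow_zero,
        Pi.mul_apply]
      field_simp
      ring
  have hF1 : F 1 = 0 ∧ F (-1) = 0 := by
    have : (0 : ℝ) ^ (α + 1) = 0 := Real.zero_rpow (by linarith)
    constructor <;> simp [hF, this]
  rw [hF1.1, hF1.2, hG, intervalIntegral.integral_add (i1.sub i2) i3,
    intervalIntegral.integral_sub i1 i2, intervalIntegral.integral_const_mul,
    intervalIntegral.integral_const_mul] at hint
  simp only [weightIntegral]
  linarith

end WeightIntegral

/-! ### Orthogonality, three-term recurrence and the product formula for the determinant. -/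

section OrthogonalPolynomials

variable {α t : ℝ}

theorem jacobiPairing_eq_weightIntegral (p q : ℝ[X]) :
    jacobiPairing α t p q = weightIntegral α t 0 (p * q) := by
  simp [jacobiPairing, weightIntegral]

theorem jacobiPairing_comm (p q : ℝ[X]) : jacobiPairing α t p q = jacobiPairing α t q p := by
  simp only [jacobiPairing_eq_weightIntegral, mul_comm]

theorem jacobiH_eq_weightIntegral (n : ℕ) :
    jacobiH α t n = weightIntegral α t 0 (jacobiP α t n * jacobiP α t n) :=
  jacobiPairing_eq_weightIntegral _ _

theorem jacobiP_eq (n : ℕ) : jacobiP α t n = X ^ n - ∑ j ∈ Finset.range n,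
    C (jacobiPairing α t (X ^ n) (jacobiP α t j) / jacobiH α t j) * jacobiP α t j := by
  rw [jacobiP, Finset.sum_range]
  rfl

theorem jacobiP_monic_and_natDegree (n : ℕ) :
    (jacobiP α t n).Monic ∧ (jacobiP α t n).natDegree = n := by
  induction n using Nat.strong_induction_on with
  | _ n ih =>
    have hdeg : (∑ j ∈ Finset.range n, C (jacobiPairing α t (X ^ n) (jacobiP α t j) /
        jacobiH α t j) * jacobiP α t j).degree < n := by
      rw [← mem_degreeLT]
      refine Submodule.sum_mem _ fun j hj => ?_
      have hj := Finset.mem_range.1 hj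
      rw [← smul_eq_C_mul]
      refine Submodule.smul_mem _ _ (mem_degreeLT.2 ?_)
      rw [degree_eq_natDegree (ih j hj).1.ne_zero, (ih j hj).2]
      exact_mod_cast hj
    rw [jacobiP_eq]
    refine ⟨monic_X_pow_sub hdeg, ?_⟩
    rw [natDegree_eq_of_degree_eq (degree_sub_eq_left_of_degree_lt (by rwa [degree_X_pow])),
      natDegree_X_pow]

theorem jacobiP_monic (n : ℕ) : (jacobiP α t n).Monic := (jacobiP_monic_and_natDegree n).1

theorem jacobiP_natDegree (n : ℕ) : (jacobiP α t n).natDegree = n :=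
  (jacobiP_monic_and_natDegree n).2

theorem jacobiP_degree (n : ℕ) : (jacobiP α t n).degree = n := by
  rw [degree_eq_natDegree (jacobiP_monic n).ne_zero, jacobiP_natDegree]

theorem jacobiP_coeff_self (n : ℕ) : (jacobiP α t n).coeff n = 1 := by
  have h := jacobiP_monic (α := α) (t := t) n
  rwa [Monic, leadingCoeff, jacobiP_natDegree] at h

theorem jacobiP_coeff_of_lt {n k : ℕ} (h : n < k) : (jacobiP α t n).coeff k = 0 :=
  coeff_eq_zero_of_natDegree_lt (by rwa [jacobiP_natDegree])

theorem jacobiP_zero : jacobiP α t 0 = 1 := by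
  rw [jacobiP_eq]; simp

variable (hα : 0 < α) (ht : 0 < t)
include hα ht

theorem jacobiH_pos (n : ℕ) : 0 < jacobiH α t n := by
  rw [jacobiH_eq_weightIntegral]
  exact weightIntegral_mul_self_pos hα ht (jacobiP_monic n).ne_zero

theorem jacobiPairing_jacobiP_of_lt {n j : ℕ} (hj : j < n) :
    jacobiPairing α t (jacobiP α t n) (jacobiP α t j) = 0 := by
  induction n using Nat.strong_induction_on generalizing j with
  | _ n ih =>
    have hoff : ∀ i < n, i ≠ j → jacobiPairing α t (jacobiP α t i) (jacobiP α t j) = 0 := by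
      intro i hi hij
      rcases lt_or_gt_of_ne hij with h | h
      · rw [jacobiPairing_comm]; exact ih j hj h
      · exact ih i hi h
    rw [jacobiP_eq n, jacobiPairing_eq_weightIntegral, sub_mul, weightIntegral_sub hα ht,
      Finset.sum_mul, weightIntegral_sum hα ht, Finset.sum_eq_single j, mul_assoc,
      weightIntegral_C_mul, ← jacobiH_eq_weightIntegral,
      div_mul_cancel₀ _ (jacobiH_pos hα ht j).ne', jacobiPairing_eq_weightIntegral, sub_self]
    · intro i hi hij
      rw [mul_assoc, weightIntegral_C_mul, ← jacobiPairing_eq_weightIntegral (jacobiP α t i),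
        hoff i (Finset.mem_range.1 hi) hij, mul_zero]
    · intro h
      exact absurd (Finset.mem_range.2 hj) h

theorem jacobiP_isMonicOrthogonal : IsMonicOrthogonal α t (jacobiP α t) where
  monic := jacobiP_monic
  natDegree_eq := jacobiP_natDegree
  orthogonal j k hjk := by
    rcases lt_or_gt_of_ne hjk with h | h
    · rw [jacobiPairing_comm]; exact jacobiPairing_jacobiP_of_lt hα ht h
    · exact jacobiPairing_jacobiP_of_lt hα ht h
  norm_pos := jacobiH_pos hα ht

/-- The P_j with j < N span the polynomials of degree < N; the induction peels off the leading term
of q. -/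
theorem weightIntegral_mul_eq_zero {f : ℝ[X]} {N : ℕ}
    (hf : ∀ j < N, weightIntegral α t 0 (f * jacobiP α t j) = 0) {q : ℝ[X]} (hq : q.degree < N) :
    weightIntegral α t 0 (f * q) = 0 := by
  induction N generalizing q with
  | zero =>
    have : q = 0 := by
      rw [← degree_eq_bot]; exact Nat.WithBot.lt_zero_iff.1 (by simpa using hq)
    simp [this, weightIntegral]
  | succ d ih =>
    have hlow : (q - C (q.coeff d) * jacobiP α t d).degree < d := by
      rw [degree_lt_iff_coeff_zero] at hq ⊢
      intro k hk
      rcases hk.eq_or_lt with rfl | hk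
      · simp [jacobiP_coeff_self]
      · simp [jacobiP_coeff_of_lt hk, hq k hk]
    have h := ih (fun j hj => hf j (by omega)) hlow
    rw [mul_sub, weightIntegral_sub hα ht, mul_left_comm, weightIntegral_C_mul,
      hf d (by omega)] at h
    simpa using h

theorem weightIntegral_jacobiP_mul_of_degree_lt {n : ℕ} {q : ℝ[X]} (hq : q.degree < n) :
    weightIntegral α t 0 (jacobiP α t n * q) = 0 :=
  weightIntegral_mul_eq_zero hα ht (fun j hj => by
    rw [← jacobiPairing_eq_weightIntegral]; exact jacobiPairing_jacobiP_of_lt hα ht hj) hq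

theorem weightIntegral_jacobiP_mul {n : ℕ} {q : ℝ[X]} (hq : q.natDegree ≤ n) :
    weightIntegral α t 0 (jacobiP α t n * q) = q.coeff n * jacobiH α t n := by
  have hlow : (q - C (q.coeff n) * jacobiP α t n).degree < n := by
    rw [degree_lt_iff_coeff_zero]
    intro k hk
    rcases hk.eq_or_lt with rfl | hk
    · simp [jacobiP_coeff_self]
    · simp [jacobiP_coeff_of_lt hk, coeff_eq_zero_of_natDegree_lt (hq.trans_lt hk)]
  have h := weightIntegral_jacobiP_mul_of_degree_lt hα ht hlow
  rw [mul_sub, weightIntegral_sub hα ht, mul_left_comm, weightIntegral_C_mul,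
    ← jacobiH_eq_weightIntegral] at h
  linarith

omit hα ht in
-- A Gram–Schmidt coefficient linking degrees of opposite parity is the integral of an odd function,
-- so only terms of the parity of n survive.
theorem jacobiP_comp_neg (n : ℕ) :
    (jacobiP α t n).comp (-X) = C ((-1) ^ n) * jacobiP α t n := by
  induction n using Nat.strong_induction_on with
  | _ n ih =>
    rw [jacobiP_eq n, mul_sub, Finset.mul_sum, sub_comp, X_pow_comp, neg_pow]
    congr 1
    · simp
    · rw [sum_comp]
      refine Finset.sum_congr rfl fun j hj => ?_
      rw [mul_comp, C_comp, ih j (Finset.mem_range.1 hj), ← mul_assoc, ← mul_assoc, ← C_mul, ← C_mul]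
      congr 2
      rcases neg_one_pow_eq_or ℝ n with hn | hn <;> rcases neg_one_pow_eq_or ℝ j with hj' | hj'
      · rw [hn, hj', mul_comm]
      · rw [jacobiPairing_eq_weightIntegral, weightIntegral_eq_zero_of_comp_neg]
        · simp
        · rw [mul_comp, ih j (Finset.mem_range.1 hj), X_pow_comp, neg_pow, hj']
          have : ((-1 : ℝ[X])) ^ n = C ((-1) ^ n) := by simp
          rw [this, hn]; simp
      · rw [jacobiPairing_eq_weightIntegral, weightIntegral_eq_zero_of_comp_neg]
        · simp
        · rw [mul_comp, ih j (Finset.mem_range.1 hj), X_pow_comp, neg_pow, hj']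
          have : ((-1 : ℝ[X])) ^ n = C ((-1) ^ n) := by simp
          rw [this, hn]; simp
      · rw [hn, hj', mul_comm]

/-- The coefficients `β_n = h_n / h_{n-1}` of the three-term recurrence, with `β_0 = 0`. -/
noncomputable def recCoeff (α t : ℝ) : ℕ → ℝ
  | 0 => 0
  | n + 1 => jacobiH α t (n + 1) / jacobiH α t n

omit hα ht in
theorem weightIntegral_X_mul_jacobiP_mul_self (n : ℕ) :
    weightIntegral α t 0 (X * jacobiP α t n * jacobiP α t n) = 0 := by
  refine weightIntegral_eq_zero_of_comp_neg _ _ ?_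
  rw [mul_comp, mul_comp, jacobiP_comp_neg, X_comp]
  have h : (C ((-1 : ℝ) ^ n)) * C ((-1) ^ n) = (1 : ℝ[X]) := by
    rw [← C_mul, ← mul_pow]; simp
  simp only [zero_add, pow_one, C_neg, C_1]
  linear_combination (-(X * jacobiP α t n * jacobiP α t n)) * h

theorem eq_zero_of_weightIntegral_mul_jacobiP {N : ℕ} {f : ℝ[X]} (hdeg : f.degree < N)
    (hf : ∀ j < N, weightIntegral α t 0 (f * jacobiP α t j) = 0) : f = 0 := by
  by_contra h
  exact (weightIntegral_mul_self_pos hα ht h).ne' (weightIntegral_mul_eq_zero hα ht hf hdeg)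

/-- The difference of the two sides has degree < n + 2 and is orthogonal to P_j for all j < n + 2,
hence to itself. Parity removes the diagonal recurrence coefficient. -/
theorem jacobiP_succ_succ (n : ℕ) : jacobiP α t (n + 2) =
    X * jacobiP α t (n + 1) - C (recCoeff α t (n + 1)) * jacobiP α t n := by
  have key : X * jacobiP α t (n + 1) - C (recCoeff α t (n + 1)) * jacobiP α t n
      - jacobiP α t (n + 2) = 0 := by
    refine eq_zero_of_weightIntegral_mul_jacobiP hα ht (N := n + 2) ?_ fun j hj => ?_
    · rw [degree_lt_iff_coeff_zero]
      intro k hk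
      obtain ⟨k, rfl⟩ : ∃ l, k = l + 1 := ⟨k - 1, by omega⟩
      rw [coeff_sub, coeff_sub, coeff_X_mul, coeff_C_mul, jacobiP_coeff_of_lt (k := k + 1) (n := n)
        (by omega)]
      rcases hk.eq_or_lt with hk | hk
      · obtain rfl : k = n + 1 := by omega
        rw [jacobiP_coeff_self, jacobiP_coeff_self]; ring
      · rw [jacobiP_coeff_of_lt (show n + 1 < k by omega), jacobiP_coeff_of_lt hk]; ring
    · rw [sub_mul, sub_mul, weightIntegral_sub hα ht, weightIntegral_sub hα ht, mul_assoc (C _),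
        weightIntegral_C_mul, ← jacobiPairing_eq_weightIntegral (jacobiP α t (n + 2)),
        jacobiPairing_jacobiP_of_lt hα ht hj, sub_zero]
      rcases (show j = n + 1 ∨ j ≤ n by omega) with rfl | hjn
      · rw [weightIntegral_X_mul_jacobiP_mul_self, mul_comm (jacobiP α t n),
          ← jacobiPairing_eq_weightIntegral, jacobiPairing_jacobiP_of_lt hα ht (Nat.lt_succ_self n)]
        ring
      · have hmul : X * jacobiP α t (n + 1) * jacobiP α t j =
            jacobiP α t (n + 1) * (X * jacobiP α t j) := by ring
        have hd : (X * jacobiP α t j).natDegree = j + 1 := by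
          rw [natDegree_X_mul (jacobiP_monic j).ne_zero, jacobiP_natDegree]
        rw [hmul, weightIntegral_jacobiP_mul hα ht (by omega), coeff_X_mul]
        rcases hjn.eq_or_lt with rfl | hlt
        · rw [jacobiP_coeff_self, ← jacobiH_eq_weightIntegral, recCoeff,
            div_mul_cancel₀ _ (jacobiH_pos hα ht j).ne']
          ring
        · rw [jacobiP_coeff_of_lt hlt, ← jacobiPairing_eq_weightIntegral,
            jacobiPairing_jacobiP_of_lt hα ht hlt]
          ring
  linear_combination -key

theorem jacobiP_one : jacobiP α t 1 = X := by
  have h : X - jacobiP α t 1 = 0 := by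
    refine eq_zero_of_weightIntegral_mul_jacobiP hα ht (N := 1) ?_ fun j hj => ?_
    · rw [degree_lt_iff_coeff_zero]
      intro k hk
      rcases hk.eq_or_lt with rfl | hk
      · simp [jacobiP_coeff_self]
      · simp [jacobiP_coeff_of_lt hk, coeff_X, hk.ne]
    · obtain rfl : j = 0 := by omega
      have h1 := weightIntegral_X_mul_jacobiP_mul_self (α := α) (t := t) 0
      rw [sub_mul, weightIntegral_sub hα ht, ← jacobiPairing_eq_weightIntegral (jacobiP α t 1),
        jacobiPairing_jacobiP_of_lt hα ht (by norm_num)]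
      rw [jacobiP_zero] at h1 ⊢
      simpa using h1
  exact (sub_eq_zero.1 h).symm

/-- The three-term recurrence `x P_n = P_{n+1} + β_n P_{n-1}`. -/
theorem X_mul_jacobiP (n : ℕ) : X * jacobiP α t n =
    jacobiP α t (n + 1) + C (recCoeff α t n) * jacobiP α t (n - 1) := by
  rcases n with _ | n
  · simp [jacobiP_one hα ht, jacobiP_zero, recCoeff]
  · rw [jacobiP_succ_succ hα ht]; simp

theorem recCoeff_mul_jacobiH (n : ℕ) :
    recCoeff α t (n + 1) * jacobiH α t n = jacobiH α t (n + 1) :=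
  div_mul_cancel₀ _ (jacobiH_pos hα ht n).ne'

/-- The coefficient matrix T of the P_j is unit lower triangular, and T M Tᵀ is the Gram matrix
diag(h_j). -/
theorem hankelD_eq_prod (n : ℕ) : hankelD α n t = ∏ j ∈ Finset.range n, jacobiH α t j := by
  set M : Matrix (Fin n) (Fin n) ℝ :=
    Matrix.of fun j k : Fin n => jacobiMoment α t ((j : ℕ) + (k : ℕ)) with hM
  set T : Matrix (Fin n) (Fin n) ℝ := Matrix.of fun i j : Fin n => (jacobiP α t i).coeff j with hT
  have hTdet : T.det = 1 := by
    rw [Matrix.det_of_isLowerTriangular]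
    · simp [hT, jacobiP_coeff_self]
    · intro i j hij
      exact jacobiP_coeff_of_lt (by simpa using hij)
  have hP : ∀ i : Fin n, jacobiP α t i = ∑ j : Fin n, C ((jacobiP α t i).coeff j) * X ^ (j : ℕ) := by
    intro i
    rw [← Finset.sum_range fun j => C ((jacobiP α t i).coeff j) * X ^ j]
    exact as_sum_range_C_mul_X_pow' _ (by rw [jacobiP_natDegree]; exact i.2)
  have hmom : ∀ k, jacobiMoment α t k = weightIntegral α t 0 (X ^ k) := by
    intro k; simp [jacobiMoment, weightIntegral]
  have hprod : T * M * T.transpose = Matrix.diagonal fun i : Fin n => jacobiH α t i := by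
    ext i k
    have hik : jacobiPairing α t (jacobiP α t i) (jacobiP α t k) =
        (Matrix.diagonal fun i : Fin n => jacobiH α t i) i k := by
      rcases eq_or_ne i k with rfl | h
      · simp [jacobiH]
      · rw [Matrix.diagonal_apply_ne _ h]
        exact (jacobiP_isMonicOrthogonal hα ht).orthogonal _ _ (fun h' => h (Fin.ext h'))
    rw [← hik, jacobiPairing_eq_weightIntegral]
    conv_rhs => rw [hP i, hP k]
    rw [Finset.sum_mul_sum, weightIntegral_sum hα ht, Matrix.mul_apply]
    simp only [weightIntegral_sum hα ht, Matrix.mul_apply, Finset.sum_mul]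
    rw [Finset.sum_comm]
    refine Finset.sum_congr rfl fun j _ => Finset.sum_congr rfl fun l _ => ?_
    have : C ((jacobiP α t i).coeff j) * X ^ (j : ℕ) * (C ((jacobiP α t k).coeff l) * X ^ (l : ℕ)) =
        C ((jacobiP α t i).coeff j) * (C ((jacobiP α t k).coeff l) * X ^ ((j : ℕ) + l)) := by
      rw [pow_add]; ring
    rw [this, weightIntegral_C_mul, weightIntegral_C_mul, ← hmom]
    simp only [hT, hM, Matrix.of_apply, Matrix.transpose_apply]
    ring
  have hdet := congrArg Matrix.det hprod
  rw [Matrix.det_mul, Matrix.det_mul, Matrix.det_transpose, hTdet, Matrix.det_diagonal] at hdet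
  rw [Finset.prod_range, ← hdet, hankelD]
  ring

theorem hankelD_pos (n : ℕ) : 0 < hankelD α n t := by
  rw [hankelD_eq_prod hα ht]
  exact Finset.prod_pos fun j _ => jacobiH_pos hα ht j

end OrthogonalPolynomials

/-! ### Difference equations in n and their first integrals. -/

section Recurrences

variable {α t : ℝ}

/-- The coefficients `r_n = (2t / h_{n-1}) ∫ P_n P_{n-1} w / y³ dy`, with `r_0 = 0`. -/
noncomputable def ladderCoeff (α t : ℝ) : ℕ → ℝ
  | 0 => 0
  | n + 1 => 2 * t / jacobiH α t n * weightIntegral α t 3 (jacobiP α t (n + 1) * jacobiP α t n)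

theorem auxR_eq (n : ℕ) : auxR α n t =
    2 * t / jacobiH α t n * weightIntegral α t 2 (jacobiP α t n * jacobiP α t n) := by
  simp only [auxR, weightIntegral, eval_mul, sq, mul_div_assoc]

variable (hα : 0 < α) (ht : 0 < t)
include hα ht

theorem weightIntegral_X_mul_jacobiP_mul (m n : ℕ) (q : ℝ[X]) :
    weightIntegral α t m (X * jacobiP α t n * q) =
      weightIntegral α t m (jacobiP α t (n + 1) * q) +
        recCoeff α t n * weightIntegral α t m (jacobiP α t (n - 1) * q) := by
  rw [X_mul_jacobiP hα ht, add_mul, weightIntegral_add hα ht, mul_assoc, weightIntegral_C_mul]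

/-- Expand x P_n · P_n w/x³ by the three-term recurrence. -/
theorem ladderCoeff_succ_add (n : ℕ) :
    ladderCoeff α t (n + 1) + ladderCoeff α t n = auxR α n t := by
  have h := weightIntegral_X_mul_jacobiP_mul hα ht 3 n (jacobiP α t n)
  rw [mul_assoc, weightIntegral_X_mul] at h
  rw [auxR_eq, h]
  rcases n with _ | n
  · simp [ladderCoeff, recCoeff]
  · simp only [ladderCoeff, recCoeff, Nat.add_sub_cancel]
    have h0 := (jacobiH_pos hα ht n).ne'
    have h1 := (jacobiH_pos hα ht (n + 1)).ne'
    rw [mul_comm (jacobiP α t n)]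
    field_simp

theorem weightIntegral_one_jacobiP_succ_mul (n : ℕ) :
    weightIntegral α t 1 (jacobiP α t (n + 1) * jacobiP α t n) =
      (1 + (-1) ^ n) / 2 * jacobiH α t n := by
  induction n with
  | zero =>
    rw [zero_add, jacobiP_one hα ht, weightIntegral_X_mul, jacobiH_eq_weightIntegral, jacobiP_zero]
    simp
  | succ n ih =>
    have h := weightIntegral_X_mul_jacobiP_mul hα ht 1 (n + 1) (jacobiP α t (n + 1))
    rw [mul_assoc, weightIntegral_X_mul, ← jacobiH_eq_weightIntegral, Nat.add_sub_cancel,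
      mul_comm (jacobiP α t n), ih] at h
    have hb := recCoeff_mul_jacobiH hα ht n
    rw [pow_succ]
    linear_combination -h - (1 + (-1) ^ n) / 2 * hb

/-- Square the recurrence for P_{n+2} and integrate against w/x²; the cross terms are the integrals
of P_{k+1} P_k w/x, which are h_k or 0 by the parity of k. At n = 0 the truncated index n - 1 is
harmless because β_0 = 0. -/
theorem recCoeff_mul_auxR_succ_sub (n : ℕ) :
    recCoeff α t (n + 1) * auxR α (n + 1) t - recCoeff α t n * auxR α (n - 1) t =
      2 * t * (-1) ^ n := by
  have h0 := (jacobiH_pos hα ht n).ne'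
  have h1 := (jacobiH_pos hα ht (n + 1)).ne'
  rcases n with _ | n
  · rw [auxR_eq, zero_add, jacobiP_one hα ht, weightIntegral_X_mul, ← mul_one X,
      weightIntegral_X_mul]
    have h := jacobiH_eq_weightIntegral (α := α) (t := t) 0
    rw [jacobiP_zero, mul_one] at h
    rw [← h]
    simp only [recCoeff]
    field_simp
    simp
  · have h2 := (jacobiH_pos hα ht n).ne'
    have e1 : jacobiP α t (n + 2) * jacobiP α t (n + 2) = X * (jacobiP α t (n + 2) *
          jacobiP α t (n + 1)) - C (recCoeff α t (n + 1)) *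
        (X * (jacobiP α t (n + 1) * jacobiP α t n)) +
        C (recCoeff α t (n + 1)) * (C (recCoeff α t (n + 1)) * (jacobiP α t n * jacobiP α t n)) := by
      rw [jacobiP_succ_succ hα ht]; ring
    have e2 : weightIntegral α t 2 (jacobiP α t (n + 2) * jacobiP α t (n + 2)) =
        (1 + (-1) ^ (n + 1)) / 2 * jacobiH α t (n + 1) -
        recCoeff α t (n + 1) * ((1 + (-1) ^ n) / 2 * jacobiH α t n) +
        recCoeff α t (n + 1) * (recCoeff α t (n + 1) *
          weightIntegral α t 2 (jacobiP α t n * jacobiP α t n)) := by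
      rw [e1, weightIntegral_add hα ht, weightIntegral_sub hα ht, weightIntegral_C_mul,
        weightIntegral_C_mul, weightIntegral_C_mul, weightIntegral_X_mul, weightIntegral_X_mul,
        weightIntegral_one_jacobiP_succ_mul hα ht, weightIntegral_one_jacobiP_succ_mul hα ht]
    rw [auxR_eq, auxR_eq, e2, Nat.add_sub_cancel]
    simp only [recCoeff]
    rw [pow_succ]
    field_simp
    ring

omit hα ht in
theorem coeff_X_sq_mul_derivative (p : ℝ[X]) (k : ℕ) :
    (X * (X * derivative p)).coeff (k + 1) = k * p.coeff k := by
  rw [coeff_X_mul]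
  rcases k with _ | k
  · simp
  · rw [coeff_X_mul, coeff_derivative]; push_cast; ring

theorem weightIntegral_jacobiP_succ_mul_X_sq_mul_derivative (n : ℕ) :
    weightIntegral α t 0 (jacobiP α t (n + 1) * (X * (X * derivative (jacobiP α t n)))) =
      n * jacobiH α t (n + 1) := by
  rw [weightIntegral_jacobiP_mul hα ht, coeff_X_sq_mul_derivative, jacobiP_coeff_self, mul_one]
  rw [natDegree_le_iff_coeff_eq_zero]
  intro k hk
  obtain ⟨k, rfl⟩ : ∃ l, k = l + 1 := ⟨k - 1, by omega⟩
  rw [coeff_X_sq_mul_derivative, jacobiP_coeff_of_lt (by omega), mul_zero]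

/-- Differentiating the recurrence for P_{n+2} relates this integral to its predecessor and adds
2β_{n+1} at each step, which builds up the sum. -/
theorem weightIntegral_X_sq_mul_derivative_mul_jacobiP (n : ℕ) :
    weightIntegral α t 0 (jacobiP α t n * (X * (X * derivative (jacobiP α t (n + 1))))) =
      ((n + 1) * recCoeff α t (n + 1) + 2 * ∑ j ∈ Finset.range (n + 1), recCoeff α t j) *
        jacobiH α t n := by
  have horth : ∀ k, weightIntegral α t 0 (jacobiP α t (k + 2) * jacobiP α t k) = 0 := fun k => by
    rw [← jacobiPairing_eq_weightIntegral]
    exact jacobiPairing_jacobiP_of_lt hα ht (by omega)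
  induction n with
  | zero =>
    have h := recCoeff_mul_jacobiH hα ht 0
    rw [jacobiH_eq_weightIntegral (0 + 1), zero_add, jacobiP_one hα ht] at h
    have e : (1 : ℝ[X]) * (X * (X * 1)) = X * X := by ring
    rw [zero_add, jacobiP_one hα ht, derivative_X, jacobiP_zero, e, ← h]
    simp [recCoeff]
  | succ n ih =>
    have e : jacobiP α t (n + 1) * (X * (X * derivative (jacobiP α t (n + 2)))) =
        (X * jacobiP α t (n + 1)) * (X * jacobiP α t (n + 1)) +
        (X * jacobiP α t (n + 1)) * (X * (X * derivative (jacobiP α t (n + 1)))) -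
        C (recCoeff α t (n + 1)) *
          (jacobiP α t (n + 1) * (X * (X * derivative (jacobiP α t n)))) := by
      rw [jacobiP_succ_succ hα ht]
      simp only [derivative_sub, derivative_mul, derivative_X, derivative_C]
      ring
    rw [e, weightIntegral_sub hα ht, weightIntegral_add hα ht, weightIntegral_C_mul,
      weightIntegral_X_mul_jacobiP_mul hα ht, weightIntegral_X_mul_jacobiP_mul hα ht,
      mul_comm (jacobiP α t (n + 1 + 1)) (X * _), mul_comm (jacobiP α t (n + 1 - 1)) (X * _),
      weightIntegral_X_mul_jacobiP_mul hα ht, weightIntegral_X_mul_jacobiP_mul hα ht,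
      Nat.add_sub_cancel, ih, weightIntegral_jacobiP_succ_mul_X_sq_mul_derivative hα ht,
      weightIntegral_jacobiP_succ_mul_X_sq_mul_derivative hα ht, ← jacobiH_eq_weightIntegral,
      ← jacobiH_eq_weightIntegral, horth, mul_comm (jacobiP α t n), horth,
      Finset.sum_range_succ _ (n + 1)]
    have h1 := recCoeff_mul_jacobiH hα ht n
    have h2 := recCoeff_mul_jacobiH hα ht (n + 1)
    push_cast
    linear_combination (-(n + 2 : ℝ)) * h2 + (recCoeff α t (n + 1) * (n + 2) +
      2 * ∑ j ∈ Finset.range (n + 1), recCoeff α t j) * h1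

/-- The coefficient `r_n` in terms of the recurrence coefficients. -/
theorem ladderCoeff_eq (n : ℕ) : ladderCoeff α t n =
    recCoeff α t n * (2 * (n + α) + 1) + t * (1 - (-1) ^ n) - n +
      2 * ∑ j ∈ Finset.range n, recCoeff α t j := by
  rcases n with _ | n
  · simp [ladderCoeff, recCoeff]
  have h0 := (jacobiH_pos hα ht n).ne'
  -- The boundary-free identity for P_{n+1} P_n: its w/x³ term is r_{n+1}, and orthogonality
  -- evaluates the others.
  have hP := weightIntegral_pearson hα ht (jacobiP α t (n + 1) * jacobiP α t n)
  have e1 : (1 - X ^ 2) * derivative (jacobiP α t (n + 1) * jacobiP α t n) =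
      jacobiP α t n * derivative (jacobiP α t (n + 1)) +
      jacobiP α t (n + 1) * derivative (jacobiP α t n) -
      jacobiP α t n * (X * (X * derivative (jacobiP α t (n + 1)))) -
      jacobiP α t (n + 1) * (X * (X * derivative (jacobiP α t n))) := by
    rw [derivative_mul]; ring
  have e2 : (1 - X ^ 2) * (jacobiP α t (n + 1) * jacobiP α t n) =
      jacobiP α t (n + 1) * jacobiP α t n - X * (X * (jacobiP α t (n + 1) * jacobiP α t n)) := by
    ring
  have e3 : X * (jacobiP α t (n + 1) * jacobiP α t n) =
      jacobiP α t (n + 1) * (X * jacobiP α t n) := by ring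
  have d1 : (derivative (jacobiP α t (n + 1))).natDegree ≤ n := by
    have h := natDegree_derivative_le (jacobiP α t (n + 1))
    rwa [jacobiP_natDegree, Nat.add_sub_cancel] at h
  have d2 : (derivative (jacobiP α t n)).degree < (n + 1 : ℕ) := by
    refine degree_derivative_le.trans_lt ?_
    rw [jacobiP_degree]
    exact_mod_cast Nat.lt_succ_self n
  have d3 : (X * jacobiP α t n).natDegree = n + 1 := by
    rw [natDegree_X_mul (jacobiP_monic n).ne_zero, jacobiP_natDegree]
  have l1 : weightIntegral α t 0 (jacobiP α t n * derivative (jacobiP α t (n + 1))) =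
      (n + 1) * jacobiH α t n := by
    rw [weightIntegral_jacobiP_mul hα ht d1, coeff_derivative, jacobiP_coeff_self, one_mul]
  have l2 : weightIntegral α t 0 (X * (jacobiP α t (n + 1) * jacobiP α t n)) =
      jacobiH α t (n + 1) := by
    rw [e3, weightIntegral_jacobiP_mul hα ht d3.le, coeff_X_mul, jacobiP_coeff_self, one_mul]
  have l3 : weightIntegral α t 3 (jacobiP α t (n + 1) * jacobiP α t n) * (2 * t) =
      ladderCoeff α t (n + 1) * jacobiH α t n := by
    rw [ladderCoeff]; field_simp
  rw [e1, e2, weightIntegral_sub hα ht, weightIntegral_sub hα ht, weightIntegral_add hα ht,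
    weightIntegral_sub hα ht, weightIntegral_X_mul, weightIntegral_X_mul,
    weightIntegral_one_jacobiP_succ_mul hα ht,
    weightIntegral_jacobiP_succ_mul_X_sq_mul_derivative hα ht,
    weightIntegral_X_sq_mul_derivative_mul_jacobiP hα ht,
    weightIntegral_jacobiP_mul_of_degree_lt hα ht d2, l1, l2] at hP
  have hb := recCoeff_mul_jacobiH hα ht n
  refine mul_right_cancel₀ h0 ?_
  rw [pow_succ]
  push_cast
  linear_combination hP - l3 - (2 * (1 + α) + n) * hb

theorem one_add_ladderCoeff_succ_sub (n : ℕ) :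
    1 + ladderCoeff α t (n + 1) - ladderCoeff α t n =
      recCoeff α t (n + 1) * (2 * (n + α) + 3 + auxR α (n + 1) t) -
        recCoeff α t n * (2 * (n + α) - 1 + auxR α (n - 1) t) := by
  have h := recCoeff_mul_auxR_succ_sub hα ht n
  rw [ladderCoeff_eq hα ht, ladderCoeff_eq hα ht, Finset.sum_range_succ, pow_succ]
  push_cast
  linear_combination -h

/-- The compatibility condition at the double pole `z² = 1`. -/
theorem compatibility_one (n : ℕ) :
    (n + ladderCoeff α t n) ^ 2 + 2 * α * (n + ladderCoeff α t n) =
      recCoeff α t n * (2 * (n + α) + 1 + auxR α n t) * (2 * (n + α) - 1 + auxR α (n - 1) t) := by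
  induction n with
  | zero => simp [ladderCoeff, recCoeff]
  | succ n ih =>
    have h1 := ladderCoeff_succ_add hα ht n
    have h2 := one_add_ladderCoeff_succ_sub hα ht n
    rw [Nat.add_sub_cancel]
    push_cast
    rw [← h1] at ih ⊢
    -- Since R_n = r_{n+1} + r_n, the increment of the left side factors as (1 + r_{n+1} -
    -- r_n)(2(n+α) + 1 + R_n), which is `h2` times the second factor.
    linear_combination ih + (2 * (n + α) + 1 + ladderCoeff α t (n + 1) + ladderCoeff α t n) * h2

/-- The compatibility condition at the pole of order four at `z = 0`. -/
theorem compatibility_two (n : ℕ) :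
    -2 * t * (-1) ^ n * ladderCoeff α t n = recCoeff α t n * auxR α n t * auxR α (n - 1) t := by
  induction n with
  | zero => simp [ladderCoeff, recCoeff]
  | succ n ih =>
    have h1 := ladderCoeff_succ_add hα ht n
    have h2 := recCoeff_mul_auxR_succ_sub hα ht n
    rw [Nat.add_sub_cancel, pow_succ]
    linear_combination ih - auxR α n t * h2 + 2 * t * (-1) ^ n * h1

/-- The compatibility condition at the double pole `z = 0`. -/
theorem compatibility_three (n : ℕ) :
    ladderCoeff α t n ^ 2 - 2 * t * (-1) ^ n * (n + ladderCoeff α t n) +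
        2 * α * t * (1 - (-1) ^ n) + ∑ j ∈ Finset.range n, auxR α j t =
      recCoeff α t n * (auxR α n t * (2 * (n + α) - 1 + auxR α (n - 1) t) +
        (2 * (n + α) + 1 + auxR α n t) * auxR α (n - 1) t) := by
  induction n with
  | zero => simp [ladderCoeff, recCoeff]
  | succ n ih =>
    have h1 := ladderCoeff_succ_add hα ht n
    have h2 := recCoeff_mul_auxR_succ_sub hα ht n
    have h3 := one_add_ladderCoeff_succ_sub hα ht n
    rw [Nat.add_sub_cancel, Finset.sum_range_succ, pow_succ]
    push_cast
    rw [← h1] at ih ⊢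
    linear_combination ih - (2 * (n + α) + 1 + ladderCoeff α t (n + 1) + ladderCoeff α t n) * h2 +
      (ladderCoeff α t (n + 1) + ladderCoeff α t n) * h3

/-- The recurrence coefficient as a linear function of `r_n` and `∑_{j<n} R_j`. -/
theorem recCoeff_mul_eq (n : ℕ) :
    recCoeff α t n * (4 * (n + α) ^ 2 - 1) = n ^ 2 + 2 * n * α + 2 * (n + α) * ladderCoeff α t n +
      2 * t * (-1) ^ n * (n + α) - 2 * α * t - ∑ j ∈ Finset.range n, auxR α j t := by
  -- In one - three + two every term β_n R_n, β_n R_{n-1} and β_n R_n R_{n-1} cancels, leaving β_n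
  -- (2(n+α)+1)(2(n+α)-1).
  linear_combination -compatibility_one hα ht n + compatibility_three hα ht n -
    compatibility_two hα ht n

end Recurrences

/-! ### Evolution in t and the equations linking r_n and σ_n. -/

section Evolution

variable {α t : ℝ}

theorem weightIntegral_jacobiP_mul_eq_sum (hα : 0 < α) (ht : 0 < t) (m n : ℕ) (q : ℝ[X]) :
    weightIntegral α t m (jacobiP α t n * q) =
      ∑ k ∈ Finset.range (n + 1), (jacobiP α t n).coeff k * weightIntegral α t m (X ^ k * q) := by
  conv_lhs => rw [as_sum_range_C_mul_X_pow' (jacobiP α t n) (n := n + 1)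
    (by rw [jacobiP_natDegree]; exact Nat.lt_succ_self n)]
  rw [Finset.sum_mul, weightIntegral_sum hα ht]
  exact Finset.sum_congr rfl fun k _ => by rw [mul_assoc, weightIntegral_C_mul]

variable (hα : 0 < α) (ht : 0 < t)
include hα ht

theorem differentiableAt_weightIntegral_jacobiP_mul {n : ℕ}
    (hn : ∀ k, DifferentiableAt ℝ (fun s => (jacobiP α s n).coeff k) t) (q : ℝ[X]) :
    DifferentiableAt ℝ (fun s => weightIntegral α s 0 (jacobiP α s n * q)) t := by
  have h : DifferentiableAt ℝ (fun s => ∑ k ∈ Finset.range (n + 1),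
      (jacobiP α s n).coeff k * weightIntegral α s 0 (X ^ k * q)) t :=
    DifferentiableAt.fun_sum fun k _ =>
      (hn k).mul (hasDerivAt_weightIntegral hα ht 0 _).differentiableAt
  refine h.congr_of_eventuallyEq ?_
  filter_upwards [Ioi_mem_nhds ht] with s hs
  exact weightIntegral_jacobiP_mul_eq_sum hα hs 0 n q

omit ht in
theorem differentiableAt_jacobiP_coeff (ht : 0 < t) (n k : ℕ) :
    DifferentiableAt ℝ (fun s => (jacobiP α s n).coeff k) t := by
  induction n using Nat.strong_induction_on generalizing k with
  | _ n ih =>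
    -- Writing h_j as the integral of P_j x^j w leaves one s-dependent polynomial per integral, as
    -- the previous lemma requires.
    have hEq : (fun s => (jacobiP α s n).coeff k) =ᶠ[nhds t] fun s => (X ^ n : ℝ[X]).coeff k -
        ∑ j ∈ Finset.range n, weightIntegral α s 0 (jacobiP α s j * X ^ n) /
          weightIntegral α s 0 (jacobiP α s j * X ^ j) * (jacobiP α s j).coeff k := by
      filter_upwards [Ioi_mem_nhds ht] with s hs
      rw [jacobiP_eq, coeff_sub, finsetSum_coeff]
      congr 1
      refine Finset.sum_congr rfl fun j _ => ?_
      rw [coeff_C_mul, weightIntegral_jacobiP_mul (q := X ^ j) hα hs (by simp),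
        jacobiPairing_eq_weightIntegral, mul_comm (X ^ n)]
      simp
    refine DifferentiableAt.congr_of_eventuallyEq ?_ hEq
    refine (differentiableAt_const _).sub (DifferentiableAt.fun_sum fun j hj => ?_)
    have hj := Finset.mem_range.1 hj
    refine DifferentiableAt.mul (DifferentiableAt.div
      (differentiableAt_weightIntegral_jacobiP_mul hα ht (ih j hj) _)
      (differentiableAt_weightIntegral_jacobiP_mul hα ht (ih j hj) _) ?_) (ih j hj k)
    rw [weightIntegral_jacobiP_mul (q := X ^ j) hα ht (by simp)]
    simpa using (jacobiH_pos hα ht j).ne'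

theorem hasDerivAt_jacobiH (n : ℕ) :
    HasDerivAt (fun s => jacobiH α s n) (-(jacobiH α t n * auxR α n t) / (2 * t)) t := by
  -- One factor is frozen at time t: q is monic of degree n, so h_n(s) is the integral of P_n(·,s) q
  -- w(·,s). The s-derivative of P_n has degree < n and drops out against q at s = t.
  set q := jacobiP α t n with hq
  have hsum : HasDerivAt (fun s => ∑ k ∈ Finset.range (n + 1),
      (jacobiP α s n).coeff k * weightIntegral α s 0 (X ^ k * q))
      (∑ k ∈ Finset.range (n + 1), (deriv (fun s => (jacobiP α s n).coeff k) t *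
        weightIntegral α t 0 (X ^ k * q) + q.coeff k * -weightIntegral α t 2 (X ^ k * q))) t :=
    HasDerivAt.fun_sum fun k _ => (differentiableAt_jacobiP_coeff hα ht n k).hasDerivAt.mul
      (hasDerivAt_weightIntegral hα ht 0 _)
  refine (hsum.congr_of_eventuallyEq ?_).congr_deriv ?_
  · filter_upwards [Ioi_mem_nhds ht] with s hs
    rw [← weightIntegral_jacobiP_mul_eq_sum hα hs, weightIntegral_jacobiP_mul hα hs
      (by rw [jacobiP_natDegree]), hq, jacobiP_coeff_self, one_mul]
  · rw [Finset.sum_add_distrib, Finset.sum_eq_zero, zero_add]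
    · simp only [mul_neg, Finset.sum_neg_distrib]
      rw [hq, ← weightIntegral_jacobiP_mul_eq_sum hα ht, auxR_eq]
      have := (jacobiH_pos hα ht n).ne'
      field_simp
    · intro k hk
      rcases (Nat.lt_succ_iff.1 (Finset.mem_range.1 hk)).eq_or_lt with rfl | hk
      · simp [jacobiP_coeff_self]
      · rw [mul_comm (X ^ k), weightIntegral_jacobiP_mul_of_degree_lt hα ht, mul_zero]
        rw [degree_X_pow]; exact_mod_cast hk

theorem hasDerivAt_recCoeff (n : ℕ) :
    HasDerivAt (fun s => recCoeff α s n)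
      (recCoeff α t n * (auxR α (n - 1) t - auxR α n t) / (2 * t)) t := by
  rcases n with _ | n
  · simpa [recCoeff] using hasDerivAt_const t (0 : ℝ)
  · have h0 := (jacobiH_pos hα ht n).ne'
    refine ((hasDerivAt_jacobiH hα ht (n + 1)).div (hasDerivAt_jacobiH hα ht n) h0).congr_deriv ?_
    rw [recCoeff, Nat.add_sub_cancel]
    field_simp
    ring

theorem sum_recCoeff_mul_auxR_sub (n : ℕ) :
    ∑ j ∈ Finset.range n, recCoeff α t j * (auxR α (j - 1) t - auxR α j t) =
      recCoeff α t n * auxR α n t - t * (1 - (-1) ^ n) := by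
  induction n with
  | zero => simp [recCoeff]
  | succ n ih =>
    have h := recCoeff_mul_auxR_succ_sub hα ht n
    rw [Finset.sum_range_succ, ih, pow_succ]
    linear_combination -h

theorem hasDerivAt_ladderCoeff (n : ℕ) :
    HasDerivAt (fun s => ladderCoeff α s n)
      (recCoeff α t n * ((2 * (n + α) + 1) * auxR α (n - 1) t - (2 * (n + α) - 1) * auxR α n t) /
        (2 * t)) t := by
  have hB : HasDerivAt (fun s => ∑ j ∈ Finset.range n, recCoeff α s j)
      (∑ j ∈ Finset.range n, recCoeff α t j * (auxR α (j - 1) t - auxR α j t) / (2 * t)) t :=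
    HasDerivAt.fun_sum fun j _ => hasDerivAt_recCoeff hα ht j
  have h := ((((hasDerivAt_recCoeff hα ht n).mul_const (2 * (n + α) + 1)).add
    ((hasDerivAt_id t).mul_const (1 - (-1) ^ n))).sub_const (n : ℝ)).add (hB.const_mul 2)
  refine (h.congr_of_eventuallyEq ?_).congr_deriv ?_
  · filter_upwards [Ioi_mem_nhds ht] with s hs
    simpa using ladderCoeff_eq hα hs n
  · rw [← Finset.sum_div, sum_recCoeff_mul_auxR_sub hα ht]
    field_simp
    ring

/-- R_n = r_{n+1} + r_n reduces this to the derivative of r_n already found. -/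
theorem differentiableAt_auxR (n : ℕ) : DifferentiableAt ℝ (fun s => auxR α n s) t := by
  have h := (hasDerivAt_ladderCoeff hα ht (n + 1)).add (hasDerivAt_ladderCoeff hα ht n)
  refine h.differentiableAt.congr_of_eventuallyEq ?_
  filter_upwards [Ioi_mem_nhds ht] with s hs
  exact (ladderCoeff_succ_add hα hs n).symm

theorem differentiableAt_hankelD (n : ℕ) : DifferentiableAt ℝ (hankelD α n) t := by
  have h : DifferentiableAt ℝ (fun s => ∏ j ∈ Finset.range n, jacobiH α s j) t :=
    DifferentiableAt.fun_finsetProd fun j _ => (hasDerivAt_jacobiH hα ht j).differentiableAt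
  refine h.congr_of_eventuallyEq ?_
  filter_upwards [Ioi_mem_nhds ht] with s hs
  exact hankelD_eq_prod hα hs n

theorem sigmaN_eq (n : ℕ) : sigmaN α n t = -∑ j ∈ Finset.range n, auxR α j t := by
  have h : HasDerivAt (fun s => ∑ j ∈ Finset.range n, Real.log (jacobiH α s j))
      (∑ j ∈ Finset.range n, -(jacobiH α t j * auxR α j t) / (2 * t) / jacobiH α t j) t :=
    HasDerivAt.fun_sum fun j _ => (hasDerivAt_jacobiH hα ht j).log (jacobiH_pos hα ht j).ne'
  have hEq : (fun s => Real.log (hankelD α n s)) =ᶠ[nhds t]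
      fun s => ∑ j ∈ Finset.range n, Real.log (jacobiH α s j) := by
    filter_upwards [Ioi_mem_nhds ht] with s hs
    rw [hankelD_eq_prod hα hs, Real.log_prod fun j _ => (jacobiH_pos hα hs j).ne']
  rw [sigmaN, (h.congr_of_eventuallyEq hEq).deriv, Finset.mul_sum, ← Finset.sum_neg_distrib]
  refine Finset.sum_congr rfl fun j _ => ?_
  have := (jacobiH_pos hα ht j).ne'
  field_simp

/-- `recCoeff_mul_eq` makes σ_n linear in β_n, r_n and t, whose derivatives are known. -/
theorem hasDerivAt_sigmaN (n : ℕ) :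
    HasDerivAt (sigmaN α n) (2 * α - 2 * (-1) ^ n * (n + α) -
      recCoeff α t n * ((2 * (n + α) + 1) * auxR α (n - 1) t + (2 * (n + α) - 1) * auxR α n t) /
        (2 * t)) t := by
  have h := ((((hasDerivAt_recCoeff hα ht n).mul_const (4 * (n + α) ^ 2 - 1)).sub
    ((hasDerivAt_ladderCoeff hα ht n).const_mul (2 * (n + α)))).sub
    ((hasDerivAt_id t).const_mul (2 * (-1) ^ n * (n + α) - 2 * α))).sub_const
    ((n : ℝ) ^ 2 + 2 * n * α)
  refine (h.congr_of_eventuallyEq ?_).congr_deriv ?_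
  · filter_upwards [Ioi_mem_nhds ht] with s hs
    have h1 := recCoeff_mul_eq hα hs n
    simp only [Pi.sub_apply, id]
    rw [sigmaN_eq hα hs]
    linear_combination -h1
  · field_simp
    ring

theorem differentiableAt_deriv_sigmaN (n : ℕ) : DifferentiableAt ℝ (deriv (sigmaN α n)) t := by
  have hβ := (hasDerivAt_recCoeff hα ht n).differentiableAt
  have hR := differentiableAt_auxR hα ht n
  have hR' := differentiableAt_auxR hα ht (n - 1)
  have h : DifferentiableAt ℝ (fun s => 2 * α - 2 * (-1) ^ n * (n + α) -
      recCoeff α s n * ((2 * (n + α) + 1) * auxR α (n - 1) s + (2 * (n + α) - 1) * auxR α n s) /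
        (2 * s)) t := by
    refine (differentiableAt_const _).sub (DifferentiableAt.div
      (hβ.mul ((hR'.const_mul _).add (hR.const_mul _))) (differentiableAt_id.const_mul 2) ?_)
    exact (mul_pos two_pos ht).ne'
  refine h.congr_of_eventuallyEq ?_
  filter_upwards [Ioi_mem_nhds ht] with s hs
  exact (hasDerivAt_sigmaN hα hs n).deriv

/-- The quadratic equation for `r_n`. -/
theorem ladderCoeff_quadratic (n : ℕ) :
    ladderCoeff α t n ^ 2 + 2 * t * (-1) ^ n * ladderCoeff α t n =
      sigmaN α n t - 2 * t * deriv (sigmaN α n) t - 2 * t * (-1) ^ n * (n + α) + 2 * α * t := by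
  -- The terms linear in R_n and R_{n-1} in σ_n' are those of the third condition; the second
  -- removes the product R_n R_{n-1}.
  rw [(hasDerivAt_sigmaN hα ht n).deriv, sigmaN_eq hα ht]
  field_simp
  linear_combination compatibility_three hα ht n - 2 * compatibility_two hα ht n

theorem ladderCoeff_quadratic_deriv (n : ℕ) :
    2 * (ladderCoeff α t n + t * (-1) ^ n) * deriv (fun s => ladderCoeff α s n) t +
        2 * (-1) ^ n * ladderCoeff α t n =
      -deriv (sigmaN α n) t - 2 * t * deriv (deriv (sigmaN α n)) t -
        2 * (-1) ^ n * (n + α) + 2 * α := by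
  have hr := (hasDerivAt_ladderCoeff hα ht n).differentiableAt.hasDerivAt
  have hs := (hasDerivAt_sigmaN hα ht n).differentiableAt.hasDerivAt
  have hs' := (differentiableAt_deriv_sigmaN hα ht n).hasDerivAt
  have hl := (hr.pow 2).add ((((hasDerivAt_id t).const_mul 2).mul_const ((-1) ^ n)).mul hr)
  have hrhs := ((hs.sub (((hasDerivAt_id t).const_mul 2).mul hs')).sub
    ((((hasDerivAt_id t).const_mul 2).mul_const ((-1) ^ n)).mul_const (n + α))).add
    ((hasDerivAt_id t).const_mul (2 * α))
  have heq := hl.unique (hrhs.congr_of_eventuallyEq ?_)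
  · simp only [id] at heq
    norm_num at heq
    linear_combination heq
  · filter_upwards [Ioi_mem_nhds ht] with s hs
    simpa using ladderCoeff_quadratic hα hs n

/-- In (a-b)² = (a+b)² - 4ab, σ_n' supplies a + b. In ab, `compatibility_two` replaces β_n R_n
R_{n-1} by -2t e r_n and `recCoeff_mul_eq` replaces the remaining β_n (4(n+α)² - 1). -/
theorem ladderCoeff_deriv_sq (n : ℕ) :
    (2 * t * deriv (fun s => ladderCoeff α s n) t) ^ 2 =
      (4 * t * ((-1) ^ n * (n + α) - α) + 2 * t * deriv (sigmaN α n) t) ^ 2 +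
        8 * t * (-1) ^ n * ladderCoeff α t n * (n ^ 2 + 2 * n * α +
          2 * (n + α) * ladderCoeff α t n + 2 * t * (-1) ^ n * (n + α) - 2 * α * t +
          sigmaN α n t) := by
  have h := recCoeff_mul_eq hα ht n
  have h2 := compatibility_two hα ht n
  rw [(hasDerivAt_sigmaN hα ht n).deriv, (hasDerivAt_ladderCoeff hα ht n).deriv, sigmaN_eq hα ht,
    ← sub_eq_add_neg, ← h]
  field_simp
  linear_combination (4 * recCoeff α t n * (4 * (n + α) ^ 2 - 1)) * h2

end Evolution

/-! ### Elimination of r_n and the differential equation. -/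

/-- Elimination of `r` and its derivative `ρ` from the quadratic equation, its derivative, and the
evolution equation. -/
theorem sigmaODE_of_quadratic {α t s s1 s2 r ρ : ℝ} {n : ℕ} (ht : t ≠ 0)
    (h1 : r ^ 2 + 2 * t * (-1) ^ n * r =
      s - 2 * t * s1 - 2 * t * (-1) ^ n * (n + α) + 2 * α * t)
    (h2 : 2 * (r + t * (-1) ^ n) * ρ + 2 * (-1) ^ n * r =
      -s1 - 2 * t * s2 - 2 * (-1) ^ n * (n + α) + 2 * α)
    (h3 : (2 * t * ρ) ^ 2 = (4 * t * ((-1) ^ n * (n + α) - α) + 2 * t * s1) ^ 2 +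
      8 * t * (-1) ^ n * r * (n ^ 2 + 2 * n * α + 2 * (n + α) * r +
        2 * t * (-1) ^ n * (n + α) - 2 * α * t + s)) :
    SigmaODE α n t s s1 s2 := by
  -- The shift y = r + t e completes the square in the quadratic, so y² is free of r, and what
  -- remains is linear in y.
  have key : ∀ e y : ℝ, (e = 1 ∨ e = -1) → r = y - t * e →
      r ^ 2 + 2 * t * e * r = s - 2 * t * s1 - 2 * t * e * (n + α) + 2 * α * t →
      2 * (r + t * e) * ρ + 2 * e * r = -s1 - 2 * t * s2 - 2 * e * (n + α) + 2 * α →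
      (2 * t * ρ) ^ 2 = (4 * t * (e * (n + α) - α) + 2 * t * s1) ^ 2 +
        8 * t * e * r * (n ^ 2 + 2 * n * α + 2 * (n + α) * r +
          2 * t * e * (n + α) - 2 * α * t + s) →
      y ^ 2 = t * (t + 2 * α - 2 * s1 - 2 * e * (n + α)) + s ∧
      (4 * t ^ 3 * s2 ^ 2
        - 4 * t ^ 2 * (2 * t + 2 * α - 2 * e * (n + α) - s1) * s2
        + 8 * t ^ 2 * s1 ^ 3
        - t * (4 * t ^ 2 + 40 * α * t - 1 + 4 * s + 24 * e * t * (n + α)) * s1 ^ 2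
        + 4 * t * (12 * α * t ^ 2 - (20 * n ^ 2 + 40 * n * α + 3) * t - α
            + e * (n + α) * (12 * t ^ 2 + 1)
            + 4 * (α - t + 3 * e * (n + α)) * s) * s1
        + 8 * (t - 2 * e * (n + α)) * s ^ 2
        + 4 * t * (2 * t ^ 2 + 1 + 14 * n ^ 2 + 28 * n * α + 8 * α ^ 2
            - 4 * e * (n + α) * (3 * t + 2 * α)) * s
        - 4 * t * (4 * α * t ^ 3 - 2 * t ^ 2 * (7 * n ^ 2 + 14 * n * α + 1)
            - 4 * α * t * (3 * n ^ 2 + 6 * n * α + 1) - n ^ 2 - 2 * n * α - 2 * α ^ 2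
            + 2 * e * (2 * t ^ 3 * (n + α)
                + 2 * (3 * n ^ 3 + 9 * n ^ 2 * α + n * (6 * α ^ 2 + 1) + α) * t
                + n * α + α ^ 2)))
      + 4 * y * (2 * e * t ^ 2 * s2
          + t * (e * (4 * n ^ 2 + 8 * n * α - 8 * α * t + 1 + 4 * s) - 8 * t * (n + α)) * s1
          - 2 * e * s ^ 2
          + 2 * (4 * t * (n + α) - e * (n ^ 2 + 2 * n * α + t ^ 2)) * s
          + 2 * t * ((n + α) * (2 * n ^ 2 + 4 * n * α + 2 * t ^ 2 + 1)
              + e * (2 * α * t ^ 2 - (5 * n ^ 2 + 10 * n * α + 1) * t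
                  - α * (2 * n ^ 2 + 4 * n * α + 1)))) = 0 := by
    rintro e y he rfl h1 h2 h3
    have hs : s = (y - t * e) ^ 2 + 2 * t * e * (y - t * e) + 2 * t * s1 + 2 * t * e * (n + α) -
      2 * α * t := by linear_combination -h1
    have hs2 : 2 * t * s2 = -s1 - 2 * e * (n + α) + 2 * α - 2 * y * ρ - 2 * e * (y - t * e) := by
      linear_combination h2
    subst hs
    rcases he with rfl | rfl
    · refine ⟨by ring, ?_⟩
      refine mul_left_cancel₀ ht ?_
      -- `hs2` times its conjugate expresses (2yρ)² through s2, and y² times `h3` then removes ρ; a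
      -- common factor t has been cancelled.
      linear_combination y ^ 2 * h3 +
        t ^ 2 * (2 * t * s2 + (s1 + 2 * (n + α) - 2 * α + 2 * (y - t)) - 2 * y * ρ) * hs2
    · refine ⟨by ring, ?_⟩
      refine mul_left_cancel₀ ht ?_
      linear_combination y ^ 2 * h3 +
        t ^ 2 * (2 * t * s2 + (s1 - 2 * (n + α) - 2 * α - 2 * (y + t)) - 2 * y * ρ) * hs2
  obtain ⟨hy, hE⟩ := key ((-1) ^ n) (r + t * (-1) ^ n) (neg_one_pow_eq_or ℝ n) (by ring) h1 h2 h3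
  unfold SigmaODE
  simp only
  rw [← hy, eq_neg_of_add_eq_zero_left hE]
  ring

theorem theorem4p1 (α : ℝ) (hα : 0 < α) (n : ℕ) (t : ℝ) (ht : 0 < t) :
    IsMonicOrthogonal α t (jacobiP α t) ∧
    0 < hankelD α n t ∧
    DifferentiableAt ℝ (hankelD α n) t ∧
    sigmaN α n t = -∑ j ∈ Finset.range n, auxR α j t ∧
    DifferentiableAt ℝ (sigmaN α n) t ∧
    DifferentiableAt ℝ (deriv (sigmaN α n)) t ∧
    SigmaODE α n t (sigmaN α n t) (deriv (sigmaN α n) t) (deriv (deriv (sigmaN α n)) t) :=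
  ⟨jacobiP_isMonicOrthogonal hα ht, hankelD_pos hα ht n, differentiableAt_hankelD hα ht n,
    sigmaN_eq hα ht n, (hasDerivAt_sigmaN hα ht n).differentiableAt,
    differentiableAt_deriv_sigmaN hα ht n, sigmaODE_of_quadratic ht.ne'
      (ladderCoeff_quadratic hα ht n) (ladderCoeff_quadratic_deriv hα ht n)
      (ladderCoeff_deriv_sq hα ht n)⟩
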